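/- Let $d,n\ge 1$ and let $u:(0,\infty)\to(0,\infty)$ be non-decreasing and continuous. Let $r_1,\dots,r_{n+1}$ be independent, identically distributed random vectors $r_k=(r_k^1,\dots,r_k^d)$ with strictly positive components. Put $r_k^*=\max_{1\le j\le d} r_k^j$, $\Delta=\{\nu\in\mathbb R^d:\nu_j\ge 0,\ \sum_{j=1}^d\nu_j=1\}$ and, for $\nu\in\Delta$, $$U(\nu)=\mathsf E\,\frac{u(\langle\nu,r_{n+1}\rangle)}{u(r_{n+1}^*)},\qquad \widehat U_n(\nu)=\frac1n\sum_{k=1}^n\frac{u(\langle\nu,r_k\rangle)}{u(r_k^*)},\qquad G_n(\nu)=\widehat U_n(\nu)-U(\nu).$$ Assume that for some $\alpha\in(0,1]$ and $K>0$ we have $|u(x)-u(y)|\le K|x-y|^\alpha$ for all $x,y>0$, and that $$A:=\sup_{x>0}\frac{x^\alpha}{u(x)}<\infty.$$ Then $$\mathsf E\sup_{\nu\in\Delta}G_n(\nu)\le 2AK\sqrt{\frac{2\ln d}{n}}\quad\text{if }\alpha=1,\qquad \mathsf E\sup_{\nu\in\Delta}G_n(\nu)\le CAK\sqrt{\frac{d-1}{\alpha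 n}}\quad\text{if }\alpha\in(0,1),$$ where $C>0$ is an absolute constant (it does not depend on $d,n,u,\alpha,K,A$ or the law of the returns). -/

import Mathlib

open MeasureTheory ProbabilityTheory

noncomputable section

namespace RelativeUtility

/-- A utility function `(0, ∞) → (0, ∞)`: positive, non-decreasing and continuous.
It is represented by a function on `ℝ` whose values outside `(0, ∞)` are irrelevant. -/
structure IsUtility (u : ℝ → ℝ) : Prop where
  pos : ∀ x, 0 < x → 0 < u x
  mono : MonotoneOn u (Set.Ioi 0)
  cont : ContinuousOn u (Set.Ioi 0)

/-- The largest return `x* = max_j x^j` of a return vector `x`. -/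
def bestReturn {d : ℕ} (x : Fin d → ℝ) : ℝ := ⨆ j, x j

/-- The relative utility `f(ν, x) = u(⟨ν, x⟩) / u(x*)` of the portfolio `ν` at the returns `x`. -/
def relUtility (u : ℝ → ℝ) {d : ℕ} (ν x : Fin d → ℝ) : ℝ :=
  u (ν ⬝ᵥ x) / u (bestReturn x)

/-- The expected relative utility `U(ν) = E f(ν, r_{n+1})`; the return vectors
`r_1, …, r_{n+1}` are indexed by `Fin (n + 1)`, so that `r_{n+1}` is the last one. -/
def trueUtility {Ω : Type*} [MeasurableSpace Ω] (P : Measure Ω) (u : ℝ → ℝ)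
    {d n : ℕ} (r : Fin (n + 1) → Ω → Fin d → ℝ)
    (ν : Fin d → ℝ) : ℝ :=
  ∫ ω, relUtility u ν (r (Fin.last n) ω) ∂P

/-- The empirical relative utility `Û_n(ν) = (1/n) ∑_{k=1}^n f(ν, r_k)`. -/
def empUtility {Ω : Type*} (u : ℝ → ℝ) {d n : ℕ} (r : Fin (n + 1) → Ω → Fin d → ℝ)
    (ν : Fin d → ℝ) (ω : Ω) : ℝ :=
  (1 / (n : ℝ)) * ∑ k : Fin n, relUtility u ν (r k.castSucc ω)

/-- The empirical process `G_n(ν) = Û_n(ν) - U(ν)`. -/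
def empProcess {Ω : Type*} [MeasurableSpace Ω] (P : Measure Ω) (u : ℝ → ℝ)
    {d n : ℕ} (r : Fin (n + 1) → Ω → Fin d → ℝ)
    (ν : Fin d → ℝ) (ω : Ω) : ℝ :=
  empUtility u r ν ω - trueUtility P u r ν

/-- The supremum of `G_n` over the simplex `Δ`. -/
def supEmpProcess {Ω : Type*} [MeasurableSpace Ω] (P : Measure Ω) (u : ℝ → ℝ)
    {d n : ℕ} (r : Fin (n + 1) → Ω → Fin d → ℝ)
    (ω : Ω) : ℝ :=
  ⨆ ν : stdSimplex ℝ (Fin d), empProcess P u r (ν : Fin d → ℝ) ω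

end RelativeUtility

end

/-!
The proof bounds the empirical process by Rademacher averages and these, in turn, by elementary
exponential moment estimates over finite sets of vectors.

* *Symmetrization.* Comparing the sample with an independent copy and exchanging the two in random
  coordinates gives `E sup G_n ≤ (2 / n) E 𝔼_ε sup_ν ∑ₖ εₖ f(ν, r_k)` with independent random signs
  `εₖ` (`integral_iSup_le_two_mul_rademacher`). It remains to bound the average over the signs for
  every fixed positive sample.
* *Increments.* With `y = x / x*`, whose coordinates lie in `(0, 1]`, the Hölder condition and the
  definition of `A` give `|f(ν, x) - f(μ, x)| ≤ A K |⟨ν - μ, y⟩| ^ α` (`abs_relUtility_sub_le`).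
* *Finite classes.* A maximum of Rademacher sums over `N` vectors of norm at most `τ` has mean at
  most `τ √(2 log N)` (`expect_le_of_le_signSum`).
* *The case `α = 1`.* By the contraction principle (`expect_iSup_signSum_le`), `f(ν, r_k)` may be
  replaced by the linear functional `A K ⟨ν, y_k⟩`, whose supremum over the simplex is a maximum
  over its `d` vertices.
* *The case `α < 1`.* The simplex has nets of `ℓ¹` radius `2 / M` with at most `(e (M + 1))^(d-1)`
  points (`exists_simplex_net`). For the distance `‖ν - μ‖₁ ^ α` the logarithm of the cardinality of
  a net of radius `2 / 2 ^ ℓ` is therefore of order `(d - 1)(ℓ + 3) / α`, and chaining along these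
  nets (`expect_iSup_signSum_le_of_nets`) sums a geometric series, with the constant `C = 60` in the
  final bound.
-/

noncomputable section

namespace RelativeUtility

open Finset
open scoped BigOperators

/-! ### Rademacher averages over finite classes -/

section Rademacher

variable {ι T : Type*} [Fintype ι]

/-- The sum `∑ₖ εₖ vₖ`, where the choice of signs `ε` is encoded by Booleans
(`true` for `1`, `false` for `-1`). Averaging over all `ε` with `𝔼 ε` gives the Rademacher
expectation. -/
def signSum (ε : ι → Bool) (v : ι → ℝ) : ℝ := ∑ k, (if ε k then 1 else -1) * v k

lemma signSum_sub (ε : ι → Bool) (v w : ι → ℝ) :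
    signSum ε (fun k => v k - w k) = signSum ε v - signSum ε w := by
  simp [signSum, mul_sub, sum_sub_distrib]

lemma signSum_const_mul (ε : ι → Bool) (c : ℝ) (v : ι → ℝ) :
    signSum ε (fun k => c * v k) = c * signSum ε v := by
  simp only [signSum, mul_sum]
  exact sum_congr rfl fun k _ => by ring

lemma abs_signSum_le (ε : ι → Bool) {v : ι → ℝ} {B : ℝ} (h : ∀ k, |v k| ≤ B) :
    |signSum ε v| ≤ Fintype.card ι * B := by
  refine (abs_sum_le_sum_abs _ _).trans ?_
  have : ∀ k ∈ (univ : Finset ι), |(if ε k then (1 : ℝ) else -1) * v k| ≤ B := fun k _ => by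
    split_ifs <;> simpa using h k
  simpa using sum_le_card_nsmul _ _ _ this

lemma signSum_not (ε : ι → Bool) (v : ι → ℝ) :
    signSum (fun k => !ε k) v = -signSum ε v := by
  simp only [signSum, ← sum_neg_distrib]
  exact sum_congr rfl fun k _ => by by_cases h : ε k = true <;> simp [h]

lemma bddAbove_range_signSum (ε : ι → Bool) {a : T → ι → ℝ} {B : ℝ}
    (h : ∀ t k, |a t k| ≤ B) : BddAbove (Set.range fun t => signSum ε (a t)) :=
  ⟨Fintype.card ι * B, by rintro _ ⟨t, rfl⟩; exact (abs_le.1 (abs_signSum_le ε (h t))).2⟩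

variable [DecidableEq ι]

/-- Rademacher sums are sub-Gaussian with variance proxy `∑ₖ vₖ²`. -/
lemma expect_exp_signSum_le (v : ι → ℝ) :
    𝔼 ε : ι → Bool, Real.exp (signSum ε v) ≤ Real.exp ((∑ k, v k ^ 2) / 2) := by
  have h1 : ∑ ε : ι → Bool, Real.exp (signSum ε v) = ∏ k, (2 * Real.cosh (v k)) := by
    have h2 : ∀ k, 2 * Real.cosh (v k) = ∑ b : Bool, Real.exp ((if b then 1 else -1) * v k) := by
      intro k
      rw [Real.cosh_eq, mul_div_cancel₀ _ two_ne_zero]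
      simp
    simp only [h2, signSum, Real.exp_sum]
    rw [prod_univ_sum, Fintype.piFinset_univ]
  rw [Fintype.expect_eq_sum_div_card, h1, prod_mul_distrib]
  simp only [prod_const, Fintype.card_fun, Fintype.card_bool, card_univ, Nat.cast_pow,
    Nat.cast_ofNat]
  rw [mul_div_cancel_left₀ _ (by positivity), sum_div, Real.exp_sum]
  exact prod_le_prod (fun k _ => (Real.cosh_pos _).le) fun k _ => Real.cosh_le_exp_half_sq _

/-- Optimizing a bound `lam x ≤ a + lam² b` over `lam > 0`. -/
lemma le_two_mul_sqrt {x a b : ℝ} (ha : 0 ≤ a) (hb : 0 ≤ b)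
    (h : ∀ lam : ℝ, 0 < lam → lam * x ≤ a + lam ^ 2 * b) : x ≤ 2 * √(a * b) := by
  rcases le_or_gt x 0 with hx | hx
  · exact hx.trans (by positivity)
  have hd : discrim b (-x) a ≤ 0 := by
    refine discrim_le_zero fun y => ?_
    rcases le_or_gt y 0 with hy | hy
    · nlinarith [mul_nonneg hb (mul_self_nonneg y), mul_nonneg hx.le (neg_nonneg.2 hy)]
    · nlinarith [h y hy]
  have h4 : (x / 2) ^ 2 ≤ a * b := by
    rw [discrim] at hd
    linarith
  linarith [Real.le_sqrt_of_sq_le h4]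

/-- Jensen's inequality for the exponential and a uniform average. -/
lemma exp_expect_le {κ : Type*} [Fintype κ] [Nonempty κ] (X : κ → ℝ) :
    Real.exp (𝔼 i, X i) ≤ 𝔼 i, Real.exp (X i) := by
  set c := 𝔼 i, X i
  have h : ∀ i ∈ (univ : Finset κ), Real.exp c * (1 + (X i - c)) ≤ Real.exp (X i) := by
    intro i _
    have := Real.add_one_le_exp (X i - c)
    calc Real.exp c * (1 + (X i - c)) ≤ Real.exp c * Real.exp (X i - c) := by
          gcongr; linarith
      _ = Real.exp (X i) := by rw [← Real.exp_add]; congr 1; ring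
  have h2 := expect_le_expect h
  rw [← mul_expect, expect_add_distrib, expect_sub_distrib, Fintype.expect_const,
    Fintype.expect_const] at h2
  simpa [c] using h2

/-- Massart's finite class lemma: the maximum of the Rademacher sums over a finite set of vectors
of Euclidean norm at most `τ` has mean at most `τ √(2 log #S)`. -/
lemma expect_le_of_le_signSum {S : Finset (ι → ℝ)} {τ : ℝ} (hτ : 0 ≤ τ)
    (hS : ∀ v ∈ S, ∑ k, v k ^ 2 ≤ τ ^ 2) {M : (ι → Bool) → ℝ}
    (hM : ∀ ε, ∃ v ∈ S, M ε ≤ signSum ε v) :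
    𝔼 ε, M ε ≤ τ * √(2 * Real.log #S) := by
  have hne : 1 ≤ #S := by
    obtain ⟨v, hv, -⟩ := hM fun _ => true
    exact card_pos.2 ⟨v, hv⟩
  have hne' : (1 : ℝ) ≤ #S := by exact_mod_cast hne
  have hlog := Real.log_nonneg hne'
  have key := le_two_mul_sqrt (x := 𝔼 ε, M ε) (b := τ ^ 2 / 2) hlog (by positivity) ?_
  · refine key.trans (le_of_eq ?_)
    rw [show Real.log #S * (τ ^ 2 / 2) = (τ / 2) ^ 2 * (2 * Real.log #S) by ring,
      Real.sqrt_mul (by positivity), Real.sqrt_sq (by positivity)]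
    ring
  intro lam hlam
  rw [← Real.exp_le_exp, mul_expect, Real.exp_add, Real.exp_log (by linarith)]
  calc Real.exp (𝔼 ε, lam * M ε) ≤ 𝔼 ε, Real.exp (lam * M ε) := exp_expect_le _
    _ ≤ 𝔼 ε : ι → Bool, ∑ v ∈ S, Real.exp (signSum ε fun k => lam * v k) := by
        refine expect_le_expect fun ε _ => ?_
        obtain ⟨v, hv, hle⟩ := hM ε
        refine le_trans ?_ (single_le_sum (f := fun v => Real.exp (signSum ε fun k => lam * v k))
          (fun _ _ => (Real.exp_pos _).le) hv)
        rw [signSum_const_mul]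
        gcongr
    _ = ∑ v ∈ S, 𝔼 ε : ι → Bool, Real.exp (signSum ε fun k => lam * v k) := expect_sum_comm _ _ _
    _ ≤ ∑ v ∈ S, Real.exp (lam ^ 2 * (τ ^ 2 / 2)) := by
        refine sum_le_sum fun v hv => (expect_exp_signSum_le _).trans ?_
        simp only [mul_pow, ← mul_sum]
        rw [mul_div_assoc]
        gcongr
        exact hS v hv
    _ = #S * Real.exp (lam ^ 2 * (τ ^ 2 / 2)) := by simp

/-! ### Contraction -/

/-- The two-point inequality behind the contraction principle. -/
lemma ciSup_add_ciSup_sub_le [Nonempty T] {h φ ψ : T → ℝ}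
    (hφψ : ∀ s t, |φ s - φ t| ≤ |ψ s - ψ t|)
    (hp : BddAbove (Set.range fun t => h t + ψ t)) (hm : BddAbove (Set.range fun t => h t - ψ t)) :
    (⨆ t, h t + φ t) + (⨆ t, h t - φ t) ≤ (⨆ t, h t + ψ t) + ⨆ t, h t - ψ t := by
  refine ciSup_add_ciSup_le fun s t => ?_
  have h1 := le_ciSup hp s
  have h2 := le_ciSup hm t
  have h3 := le_ciSup hp t
  have h4 := le_ciSup hm s
  have h5 := (le_abs_self _).trans (hφψ s t)
  rcases abs_cases (ψ s - ψ t) with ⟨h6, _⟩ | ⟨h6, _⟩ <;> linarith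

/-- One step of the contraction principle: only the coordinate `j` is changed. -/
lemma expect_iSup_signSum_le_of_eq_off [Nonempty T] {φ ψ : T → ι → ℝ} {B : ℝ} (j : ι)
    (hψB : ∀ t k, |ψ t k| ≤ B) (heq : ∀ t k, k ≠ j → φ t k = ψ t k)
    (hφψ : ∀ s t, |φ s j - φ t j| ≤ |ψ s j - ψ t j|) :
    𝔼 ε : ι → Bool, ⨆ t, signSum ε (φ t) ≤ 𝔼 ε : ι → Bool, ⨆ t, signSum ε (ψ t) := by
  -- averaging over `ε j` alone reduces the claim to the two-point inequality
  have hflip : ∀ χ : T → ι → ℝ, 𝔼 ε : ι → Bool, ⨆ t, signSum ε (χ t) =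
      𝔼 ε : ι → Bool, ⨆ t, signSum (Function.update ε j (!ε j)) (χ t) := fun χ =>
    (Fintype.expect_equiv (Function.Involutive.toPerm (fun ε : ι → Bool =>
      Function.update ε j (!ε j)) fun ε => by simp) _ _ fun _ => rfl).symm
  have hsplit : ∀ (ε : ι → Bool) (v : ι → ℝ), signSum ε v =
      (∑ k ∈ univ.erase j, (if ε k then 1 else -1) * v k) + (if ε j then 1 else -1) * v j :=
    fun ε v => by rw [sum_erase_add _ _ (mem_univ j), signSum]
  have hsplit' : ∀ (ε : ι → Bool) (v : ι → ℝ), signSum (Function.update ε j (!ε j)) v =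
      (∑ k ∈ univ.erase j, (if ε k then 1 else -1) * v k) - (if ε j then 1 else -1) * v j := by
    intro ε v
    rw [hsplit, sub_eq_add_neg]
    congr 1
    · refine sum_congr rfl fun k hk => ?_
      rw [Function.update_of_ne (ne_of_mem_erase hk)]
    · cases ε j <;> simp
  have hsum : ∀ (ε : ι → Bool) t, ∑ k ∈ univ.erase j, (if ε k then (1 : ℝ) else -1) * φ t k =
      ∑ k ∈ univ.erase j, (if ε k then 1 else -1) * ψ t k := fun ε t =>
    sum_congr rfl fun k hk => by rw [heq t k (ne_of_mem_erase hk)]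
  have key : 𝔼 ε : ι → Bool, ((⨆ t, signSum ε (φ t)) +
        ⨆ t, signSum (Function.update ε j (!ε j)) (φ t)) ≤
      𝔼 ε : ι → Bool, ((⨆ t, signSum ε (ψ t)) +
        ⨆ t, signSum (Function.update ε j (!ε j)) (ψ t)) := by
    refine expect_le_expect fun ε _ => ?_
    have b1 := bddAbove_range_signSum ε hψB
    have b2 := bddAbove_range_signSum (Function.update ε j (!ε j)) hψB
    simp only [hsplit', hsplit ε, hsum] at b1 b2 ⊢
    refine ciSup_add_ciSup_sub_le (fun s t => ?_) b1 b2
    simpa only [← mul_sub, abs_mul] using mul_le_mul_of_nonneg_left (hφψ s t) (abs_nonneg _)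
  rw [expect_add_distrib, expect_add_distrib, ← hflip, ← hflip] at key
  linarith

/-- The Ledoux–Talagrand contraction principle for Rademacher averages, in the form of a
comparison of two processes with dominated coordinatewise increments. -/
lemma expect_iSup_signSum_le [Nonempty T] {φ ψ : T → ι → ℝ} {B : ℝ}
    (hφB : ∀ t k, |φ t k| ≤ B) (hψB : ∀ t k, |ψ t k| ≤ B)
    (hφψ : ∀ k s t, |φ s k - φ t k| ≤ |ψ s k - ψ t k|) :
    𝔼 ε : ι → Bool, ⨆ t, signSum ε (φ t) ≤ 𝔼 ε : ι → Bool, ⨆ t, signSum ε (ψ t) := by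
  have key : ∀ s : Finset ι, 𝔼 ε : ι → Bool, ⨆ t, signSum ε (φ t) ≤
      𝔼 ε : ι → Bool, ⨆ t, signSum ε (fun k => if k ∈ s then ψ t k else φ t k) := by
    intro s
    induction s using Finset.induction_on with
    | empty => simp
    | insert j s hj ih =>
      refine ih.trans (expect_iSup_signSum_le_of_eq_off (B := B) j ?_ ?_ ?_)
      · intro t k
        split_ifs
        exacts [hψB t k, hφB t k]
      · intro t k hk
        simp [hk]
      · intro s' t
        simpa [hj] using hφψ j s' t
  simpa using key univ

/-! ### Chaining -/

/-- Chaining: if the points of `T` are approximated by the finite sets `S ℓ` at scale `D / 2 ^ ℓ`,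
and `log #(S ℓ)` grows at most linearly in `ℓ`, then the Rademacher process is bounded on average
by a multiple of `D √(n H)`. -/
lemma expect_iSup_signSum_le_of_nets [Nonempty T] {a : T → ι → ℝ} {D H : ℝ}
    (hD : 0 ≤ D) (hH : 0 ≤ H) (S : ℕ → Finset T) (π : ℕ → T → T) (hπ : ∀ ℓ t, π ℓ t ∈ S ℓ)
    (hS0 : #(S 0) = 1) (hS : ∀ ℓ, Real.log #(S ℓ) ≤ H * (ℓ + 3))
    (ha : ∀ ℓ t k, |a t k - a (π ℓ t) k| ≤ D * (1 / 2) ^ ℓ) :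
    𝔼 ε : ι → Bool, ⨆ t, signSum ε (a t) ≤ 15 * D * √(Fintype.card ι * H) := by
  classical
  set n : ℝ := (Fintype.card ι : ℝ)
  -- the vectors `a (π (ℓ + 1) t) - a (π ℓ t)` form a finite set `L ℓ` of vectors of small norm
  let V : ℕ → T × T → ι → ℝ := fun ℓ p k => a p.1 k - a p.2 k
  let L : ℕ → Finset (ι → ℝ) := fun ℓ => ((S (ℓ + 1) ×ˢ S ℓ).image (V ℓ)).filter
    fun v => ∀ k, |v k| ≤ 3 / 2 * D * (1 / 2) ^ ℓ
  have hVL : ∀ ℓ t, V ℓ (π (ℓ + 1) t, π ℓ t) ∈ L ℓ := by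
    intro ℓ t
    refine mem_filter.2 ⟨mem_image_of_mem _ (mem_product.2 ⟨hπ _ _, hπ _ _⟩), fun k => ?_⟩
    have h1 := abs_le.1 (ha (ℓ + 1) t k)
    have h2 := abs_le.1 (ha ℓ t k)
    rw [pow_succ] at h1
    simp only [V]
    exact abs_le.2 ⟨by linarith, by linarith⟩
  have hLne : ∀ ℓ, (L ℓ).Nonempty := fun ℓ => ⟨_, hVL ℓ (Classical.arbitrary T)⟩
  have hScard : ∀ ℓ, (1 : ℝ) ≤ #(S ℓ) := fun ℓ => by
    exact_mod_cast card_pos.2 ⟨_, hπ ℓ (Classical.arbitrary T)⟩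
  have hLcard : ∀ ℓ, Real.log #(L ℓ) ≤ H * (2 * ℓ + 7) := by
    intro ℓ
    have h1 : (#(L ℓ) : ℝ) ≤ #(S (ℓ + 1)) * #(S ℓ) := by
      exact_mod_cast ((card_filter_le _ _).trans card_image_le).trans (card_product _ _).le
    have h2 : (0 : ℝ) < #(L ℓ) := by exact_mod_cast card_pos.2 (hLne ℓ)
    refine (Real.log_le_log h2 h1).trans ?_
    rw [Real.log_mul (by linarith [hScard (ℓ + 1)]) (by linarith [hScard ℓ])]
    have h3 := hS (ℓ + 1)
    have h4 := hS ℓ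
    push_cast at h3
    linarith
  let X : ℕ → (ι → Bool) → ℝ := fun ℓ ε => (L ℓ).sup' (hLne ℓ) (signSum ε)
  have hX : ∀ ℓ, 𝔼 ε, X ℓ ε ≤ 3 / 2 * D * √(n * H) * ((ℓ + 4) * (1 / 2) ^ ℓ) := by
    intro ℓ
    have h1 : 𝔼 ε, X ℓ ε ≤ (√n * (3 / 2 * D * (1 / 2) ^ ℓ)) * √(2 * Real.log #(L ℓ)) := by
      refine expect_le_of_le_signSum (by positivity) (fun v hv => ?_) fun ε => ?_
      · have h2 : ∀ k ∈ (univ : Finset ι), v k ^ 2 ≤ (3 / 2 * D * (1 / 2) ^ ℓ) ^ 2 := fun k _ =>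
          sq_le_sq' (abs_le.1 ((mem_filter.1 hv).2 k)).1 (abs_le.1 ((mem_filter.1 hv).2 k)).2
        refine (sum_le_card_nsmul _ _ _ h2).trans (le_of_eq ?_)
        rw [nsmul_eq_mul, card_univ, mul_pow √n, Real.sq_sqrt (by positivity)]
      · obtain ⟨v, hv, h⟩ := exists_mem_eq_sup' (hLne ℓ) (signSum ε)
        exact ⟨v, hv, h.le⟩
    have h2 : √(2 * Real.log #(L ℓ)) ≤ √H * (ℓ + 4) := by
      rw [← Real.sqrt_sq (show (0 : ℝ) ≤ ℓ + 4 by positivity), ← Real.sqrt_mul hH]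
      refine Real.sqrt_le_sqrt ?_
      have h3 : H * (4 * ℓ + 14) ≤ H * (ℓ + 4 : ℝ) ^ 2 :=
        mul_le_mul_of_nonneg_left (by nlinarith [(Nat.cast_nonneg ℓ : (0 : ℝ) ≤ ℓ)]) hH
      linarith [hLcard ℓ]
    refine h1.trans ((mul_le_mul_of_nonneg_left h2 (by positivity)).trans (le_of_eq ?_))
    rw [Real.sqrt_mul (by positivity)]
    ring
  obtain ⟨t₀, ht₀⟩ := card_eq_one.1 hS0
  have hπ0 : ∀ t, π 0 t = t₀ := fun t => by simpa [ht₀] using hπ 0 t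
  have hstart : 𝔼 ε : ι → Bool, signSum ε (a t₀) ≤ 0 := by
    have := expect_le_of_le_signSum (S := {a t₀}) (τ := √(∑ k, a t₀ k ^ 2)) (by positivity)
      (by simp [Real.sq_sqrt (sum_nonneg fun k _ => sq_nonneg (a t₀ k))])
      (M := fun ε => signSum ε (a t₀)) (by simp)
    simpa using this
  have hgeom : ∀ q : ℕ, ∑ ℓ ∈ range q, ((ℓ + 4 : ℝ) * (1 / 2) ^ ℓ) =
      10 - (2 * q + 10) * (1 / 2) ^ q := by
    intro q
    induction q with
    | zero => norm_num
    | succ q ih => rw [sum_range_succ, ih]; push_cast; ring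
  have hchain : ∀ (q : ℕ) ε t, signSum ε (a (π q t)) ≤
      signSum ε (a t₀) + ∑ ℓ ∈ range q, X ℓ ε := by
    intro q ε t
    induction q with
    | zero => simp [hπ0]
    | succ q ih =>
      have h1 : signSum ε (V q (π (q + 1) t, π q t)) ≤ X q ε := le_sup' _ (hVL q t)
      simp only [V, signSum_sub] at h1
      rw [sum_range_succ]
      linarith
  have hq : ∀ q : ℕ, 𝔼 ε : ι → Bool, ⨆ t, signSum ε (a t) ≤
      15 * D * √(n * H) + n * D * (1 / 2) ^ q := by
    intro q
    have h1 : 𝔼 ε : ι → Bool, ⨆ t, signSum ε (a t) ≤ 𝔼 ε : ι → Bool,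
        (signSum ε (a t₀) + ∑ ℓ ∈ range q, X ℓ ε + n * D * (1 / 2) ^ q) := by
      refine expect_le_expect fun ε _ => ciSup_le fun t => ?_
      have h2 := (abs_le.1 (abs_signSum_le ε (ha q t))).2
      rw [signSum_sub] at h2
      linarith [hchain q ε t]
    rw [expect_add_distrib, expect_add_distrib, expect_sum_comm, Fintype.expect_const] at h1
    have h3 : ∑ ℓ ∈ range q, 𝔼 ε, X ℓ ε ≤ 3 / 2 * D * √(n * H) * 10 := by
      refine (sum_le_sum fun ℓ _ => hX ℓ).trans ?_
      rw [← mul_sum, hgeom]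
      refine mul_le_mul_of_nonneg_left ?_ (by positivity)
      have : (0 : ℝ) ≤ (2 * q + 10) * (1 / 2) ^ q := by positivity
      linarith
    linarith
  have hlim : Filter.Tendsto (fun q : ℕ => 15 * D * √(n * H) + n * D * (1 / 2) ^ q) Filter.atTop
      (nhds (15 * D * √(n * H) + n * D * 0)) :=
    ((tendsto_pow_atTop_nhds_zero_of_lt_one (by norm_num) (by norm_num)).const_mul _).const_add _
  simpa using ge_of_tendsto' hlim hq

end Rademacher

/-! ### Symmetrization -/

section Symmetrization

variable {ι T X : Type*} [TopologicalSpace T] [TopologicalSpace.SeparableSpace T] [Nonempty T]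
  [MeasurableSpace X]

omit [Nonempty T] in
/-- A supremum over a separable space of random variables depending continuously on the
parameter is measurable, because it can be taken over a countable dense set. -/
lemma measurable_iSup_of_continuous {g : T → X → ℝ} (hc : ∀ x, Continuous (g · x))
    (hm : ∀ t, Measurable (g t)) : Measurable fun x => ⨆ t, g t x := by
  obtain ⟨s, hs, hd⟩ := TopologicalSpace.exists_countable_dense T
  have : Countable s := hs
  have h : (fun x => ⨆ t, g t x) = fun x => ⨆ t : s, g t x :=
    funext fun x => (hd.ciSup' (hc x)).symm
  rw [h]
  exact Measurable.iSup fun t => hm t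

omit [TopologicalSpace T] [TopologicalSpace.SeparableSpace T] [MeasurableSpace X] in
lemma abs_iSup_le {g : T → ℝ} {B : ℝ} (hB : ∀ t, |g t| ≤ B) : |⨆ t, g t| ≤ B := by
  obtain ⟨t₀⟩ := ‹Nonempty T›
  refine abs_le.2 ⟨(abs_le.1 (hB t₀)).1.trans (le_ciSup (f := g) ⟨B, ?_⟩ t₀),
    ciSup_le fun t => (abs_le.1 (hB t)).2⟩
  rintro _ ⟨t, rfl⟩
  exact (abs_le.1 (hB t)).2

lemma integrable_iSup_of_continuous {μ : Measure X} [IsFiniteMeasure μ] {g : T → X → ℝ} {B : ℝ}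
    (hc : ∀ x, Continuous (g · x)) (hm : ∀ t, Measurable (g t)) (hB : ∀ t x, |g t x| ≤ B) :
    Integrable (fun x => ⨆ t, g t x) μ :=
  .of_bound (measurable_iSup_of_continuous hc hm).aestronglyMeasurable B
    (Filter.Eventually.of_forall fun x => by
      rw [Real.norm_eq_abs]
      exact abs_iSup_le fun t => hB t x)

variable [Fintype ι] {μ : Measure X} [IsProbabilityMeasure μ]

omit [Nonempty T] [TopologicalSpace T] [TopologicalSpace.SeparableSpace T] in
/-- Exchanging the two independent samples in an arbitrary set of coordinates does not change
their joint law. -/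
lemma measurePreserving_swap_coords (ε : ι → Bool) :
    MeasurePreserving (fun p : (ι → X) × (ι → X) =>
        ((fun k => if ε k then p.1 k else p.2 k), fun k => if ε k then p.2 k else p.1 k))
      ((Measure.pi fun _ => μ).prod (Measure.pi fun _ => μ))
      ((Measure.pi fun _ => μ).prod (Measure.pi fun _ => μ)) := by
  have he := measurePreserving_arrowProdEquivProdArrow X X ι (fun _ => μ) (fun _ => μ)
  have hs : MeasurePreserving (fun (z : ι → X × X) k => if ε k then z k else (z k).swap)
      (Measure.pi fun _ => μ.prod μ) (Measure.pi fun _ => μ.prod μ) :=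
    measurePreserving_pi (fun _ : ι => μ.prod μ) (fun _ => μ.prod μ)
      (f := fun k z => if ε k then z else z.swap) fun k => by
      cases ε k
      · simpa using Measure.measurePreserving_swap
      · exact MeasurePreserving.id _
  convert (he.comp hs).comp (he.symm _) using 1
  funext p
  ext k <;> cases h : ε k <;> simp [h, MeasurableEquiv.arrowProdEquivProdArrow,
    Equiv.arrowProdEquivProdArrow]

variable [FirstCountableTopology T]

/-- The supremum of a centered empirical process is integrable. -/
lemma integrable_iSup_sum_sub_integral {f : T → X → ℝ} {B : ℝ}
    (hc : ∀ x, Continuous (f · x)) (hm : ∀ t, Measurable (f t)) (hB : ∀ t x, |f t x| ≤ B) :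
    Integrable (fun x : ι → X => ⨆ t, ∑ k : ι, (f t (x k) - ∫ y, f t y ∂μ))
      (Measure.pi fun _ => μ) := by
  have hci : Continuous fun t => ∫ y, f t y ∂μ :=
    continuous_of_dominated (bound := fun _ => B) (fun t => (hm t).aestronglyMeasurable)
      (fun t => Filter.Eventually.of_forall fun x => hB t x) (integrable_const B)
      (Filter.Eventually.of_forall hc)
  have hBi : ∀ t, |∫ y, f t y ∂μ| ≤ B := fun t => by
    have := norm_integral_le_of_norm_le_const (μ := μ) (f := f t) (C := B)
      (Filter.Eventually.of_forall fun x => hB t x)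
    simpa using this
  refine integrable_iSup_of_continuous
    (g := fun t (x : ι → X) => ∑ k : ι, (f t (x k) - ∫ y, f t y ∂μ))
    (B := Fintype.card ι * (B + B))
    (fun x => continuous_finsetSum _ fun k _ => (hc _).sub hci)
    (fun t => measurable_fun_sum _ fun k _ =>
      ((hm t).comp (measurable_pi_apply k)).sub measurable_const) fun t x => ?_
  simpa [signSum] using abs_signSum_le (fun _ => true) (v := fun k => f t (x k) - ∫ y, f t y ∂μ)
    fun k => (abs_sub _ _).trans (add_le_add (hB t _) (hBi t))

variable [DecidableEq ι]

/-- The symmetrization inequality: the expected supremum of a centered empirical process is at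
most twice the expected Rademacher average. -/
lemma integral_iSup_le_two_mul_rademacher {f : T → X → ℝ} {B : ℝ}
    (hc : ∀ x, Continuous (f · x)) (hm : ∀ t, Measurable (f t)) (hB : ∀ t x, |f t x| ≤ B) :
    ∫ x, ⨆ t, ∑ k : ι, (f t (x k) - ∫ y, f t y ∂μ) ∂(Measure.pi fun _ : ι => μ) ≤
      2 * ∫ x, 𝔼 ε : ι → Bool, ⨆ t, signSum ε (fun k => f t (x k))
        ∂(Measure.pi fun _ : ι => μ) := by
  set ν : Measure (ι → X) := Measure.pi fun _ : ι => μ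
  have hmk : ∀ t (k : ι), Measurable fun x : ι → X => f t (x k) := fun t k =>
    (hm t).comp (measurable_pi_apply k)
  have hintk : ∀ t (k : ι), Integrable (fun x : ι → X => f t (x k)) ν := fun t k =>
    .of_bound (hmk t k).aestronglyMeasurable B (Filter.Eventually.of_forall fun x => hB t (x k))
  -- `R ε` is the Rademacher supremum, `Q ε` its analogue for the difference of two samples
  let R : (ι → Bool) → (ι → X) → ℝ := fun ε x => ⨆ t, signSum ε (fun k => f t (x k))
  let Q : (ι → Bool) → (ι → X) × (ι → X) → ℝ := fun ε p =>
    ⨆ t, signSum ε (fun k => f t (p.1 k) - f t (p.2 k))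
  have hRint : ∀ ε, Integrable (R ε) ν := fun ε =>
    integrable_iSup_of_continuous (g := fun t (x : ι → X) => signSum ε (fun k => f t (x k)))
      (fun x => continuous_finsetSum _ fun k _ => continuous_const.mul (hc _))
      (fun t => measurable_fun_sum _ fun k _ => measurable_const.mul (hmk t k))
      fun t x => abs_signSum_le ε fun k => hB t _
  have hQbd : ∀ ε t (p : (ι → X) × (ι → X)),
      |signSum ε (fun k => f t (p.1 k) - f t (p.2 k))| ≤ Fintype.card ι * (B + B) :=
    fun ε t p => abs_signSum_le ε
      fun k => (abs_sub _ _).trans (add_le_add (hB _ _) (hB _ _))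
  have hQint : ∀ ε, Integrable (Q ε) (ν.prod ν) := fun ε =>
    integrable_iSup_of_continuous
      (g := fun t (p : (ι → X) × (ι → X)) => signSum ε (fun k => f t (p.1 k) - f t (p.2 k)))
      (fun x => continuous_finsetSum _ fun k _ => continuous_const.mul ((hc _).sub (hc _)))
      (fun t => measurable_fun_sum _ fun k _ => measurable_const.mul
        (((hmk t k).comp measurable_fst).sub ((hmk t k).comp measurable_snd)))
      (hQbd ε)
  -- replacing the mean by an independent ghost sample
  have hghost : ∫ x, ⨆ t, ∑ k : ι, (f t (x k) - ∫ y, f t y ∂μ) ∂ν ≤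
      ∫ p, Q (fun _ => true) p ∂(ν.prod ν) := by
    rw [integral_prod _ (hQint _)]
    have hsec : ∀ x, Integrable (fun y => Q (fun _ => true) (x, y)) ν := fun x =>
      integrable_iSup_of_continuous
        (g := fun t (y : ι → X) => signSum (fun _ => true) (fun k => f t (x k) - f t (y k)))
        (fun y => continuous_finsetSum _ fun k _ => continuous_const.mul ((hc _).sub (hc _)))
        (fun t => measurable_fun_sum _ fun k _ => measurable_const.mul
          (measurable_const.sub (hmk t k)))
        fun t y => hQbd _ t (x, y)
    refine integral_mono (integrable_iSup_sum_sub_integral hc hm hB) (hQint _).integral_prod_left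
      fun x => ciSup_le fun t => ?_
    have h1 : ∑ k : ι, (f t (x k) - ∫ y, f t y ∂μ) =
        ∫ y, signSum (fun _ => true) (fun k => f t (x k) - f t (y k)) ∂ν := by
      simp only [signSum, if_true, one_mul]
      rw [integral_finsetSum univ
        (f := fun k (y : ι → X) => f t (x k) - f t (y k))
        fun k _ => (integrable_const _).sub (hintk t k)]
      refine sum_congr rfl fun k _ => ?_
      rw [integral_sub (integrable_const _) (hintk t k), integral_const,
        integral_comp_eval (μ := fun _ : ι => μ) (hm t).aestronglyMeasurable]
      simp
    rw [h1]
    refine integral_mono ?_ (hsec x) fun y => ?_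
    · exact integrable_finsetSum _ fun k _ =>
        ((integrable_const _).sub (hintk t k)).const_mul _
    · exact le_ciSup (f := fun t => signSum (fun _ => true) (fun k => f t (x k) - f t (y k)))
        (bddAbove_range_signSum _ fun t k =>
          (abs_sub _ _).trans (add_le_add (hB t (x k)) (hB t (y k)))) t
  -- the joint law of the two samples is invariant under exchanging coordinates
  have hswap : ∀ ε, ∫ p, Q (fun _ => true) p ∂(ν.prod ν) = ∫ p, Q ε p ∂(ν.prod ν) := by
    intro ε
    have hmp := measurePreserving_swap_coords (μ := μ) ε
    conv_lhs => rw [← hmp.map_eq]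
    rw [integral_map hmp.measurable.aemeasurable
      (by rw [hmp.map_eq]; exact (hQint _).aestronglyMeasurable)]
    refine integral_congr_ae (Filter.Eventually.of_forall fun p => ?_)
    simp only [Q, signSum]
    congr 1
    funext t
    refine sum_congr rfl fun k _ => ?_
    cases h : ε k <;> simp
  have hsplit : ∀ ε, ∫ p, Q ε p ∂(ν.prod ν) ≤ ∫ x, R ε x ∂ν + ∫ x, R (fun k => !ε k) x ∂ν := by
    intro ε
    have h1 := (hRint ε).comp_fst ν
    have h2 := (hRint fun k => !ε k).comp_snd ν
    calc ∫ p, Q ε p ∂(ν.prod ν) ≤ ∫ p, (R ε p.1 + R (fun k => !ε k) p.2) ∂(ν.prod ν) := by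
          refine integral_mono (hQint ε) (h1.add h2) fun p => ciSup_le fun t => ?_
          rw [signSum_sub, sub_eq_add_neg, ← signSum_not]
          exact add_le_add
            (le_ciSup (bddAbove_range_signSum ε fun t k => hB t (p.1 k)) t)
            (le_ciSup (bddAbove_range_signSum (fun k => !ε k) fun t k => hB t (p.2 k)) t)
      _ = _ := by
          rw [integral_add h1 h2, integral_fun_fst, integral_fun_snd]
          simp
  have hnot : 𝔼 ε : ι → Bool, ∫ x, R (fun k => !ε k) x ∂ν = 𝔼 ε : ι → Bool, ∫ x, R ε x ∂ν :=
    Fintype.expect_equiv (Function.Involutive.toPerm (fun (ε : ι → Bool) k => !ε k)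
      fun ε => by simp) _ _ fun ε => rfl
  have hfub : ∫ x, 𝔼 ε : ι → Bool, R ε x ∂ν = 𝔼 ε : ι → Bool, ∫ x, R ε x ∂ν := by
    simp only [Fintype.expect_eq_sum_div_card]
    rw [integral_div, integral_finsetSum _ fun ε _ => hRint ε]
  calc _ ≤ ∫ p, Q (fun _ => true) p ∂(ν.prod ν) := hghost
    _ = 𝔼 ε : ι → Bool, ∫ p, Q (fun _ => true) p ∂(ν.prod ν) := by
        rw [Fintype.expect_const]
    _ ≤ 𝔼 ε : ι → Bool, (∫ x, R ε x ∂ν + ∫ x, R (fun k => !ε k) x ∂ν) :=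
        expect_le_expect fun ε _ => (hswap ε).trans_le (hsplit ε)
    _ = 2 * ∫ x, 𝔼 ε : ι → Bool, R ε x ∂ν := by
        rw [expect_add_distrib, hnot, hfub]
        ring

end Symmetrization

/-! ### Nets of the simplex -/

section Simplex

variable {d : ℕ}

lemma sum_abs_sub_le_two {ν μ : Fin d → ℝ} (hν : ν ∈ stdSimplex ℝ (Fin d))
    (hμ : μ ∈ stdSimplex ℝ (Fin d)) : ∑ j, |ν j - μ j| ≤ 2 := by
  calc ∑ j, |ν j - μ j| ≤ ∑ j, (ν j + μ j) := by
        refine sum_le_sum fun j _ => abs_le.2 ⟨?_, ?_⟩ <;> linarith [hν.1 j, hμ.1 j]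
    _ = 2 := by rw [sum_add_distrib, hν.2, hμ.2]; norm_num

/-- Rounding down all coordinates but the last to multiples of `1 / N` and giving the rest to the
last coordinate moves a point of the simplex by at most `2 m / N` in the `ℓ¹` distance. -/
lemma exists_rounding {m N : ℕ} (hN : 0 < N) {ν : Fin (m + 1) → ℝ}
    (hν : ν ∈ stdSimplex ℝ (Fin (m + 1))) :
    ∃ k : Fin (m + 1) → ℕ, ∑ j, k j = N ∧ ∑ j, |ν j - k j / N| ≤ 2 * m / N := by
  have hN' : (0 : ℝ) < N := by exact_mod_cast hN
  have hsum := hν.2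
  rw [Fin.sum_univ_castSucc] at hsum
  let q : Fin m → ℕ := fun j => ⌊N * ν j.castSucc⌋₊
  have hq : ∀ j, (q j : ℝ) ≤ N * ν j.castSucc := fun j =>
    Nat.floor_le (mul_nonneg hN'.le (hν.1 _))
  have hqN : ∑ j, q j ≤ N := by
    have h1 : (∑ j, (q j : ℝ)) ≤ N := by
      refine (sum_le_sum fun j _ => hq j).trans ?_
      rw [← mul_sum]
      nlinarith [hν.1 (Fin.last m)]
    exact_mod_cast h1
  have herr : ∀ j, |ν j.castSucc - q j / N| ≤ 1 / N := by
    intro j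
    have h1 : N * ν j.castSucc < q j + 1 := Nat.lt_floor_add_one _
    have h2 := hq j
    have h3 : ν j.castSucc - q j / N = (N * ν j.castSucc - q j) / N := by field_simp
    rw [h3, abs_div, abs_of_pos hN', abs_of_nonneg (by linarith)]
    gcongr
    linarith
  have herrs : ∑ j, |ν (Fin.castSucc j) - q j / N| ≤ m / N := by
    refine (sum_le_sum fun j _ => herr j).trans (le_of_eq ?_)
    simp [div_eq_mul_inv]
  refine ⟨Fin.snoc (α := fun _ => ℕ) q (N - ∑ j, q j), ?_, ?_⟩
  · rw [Fin.sum_univ_castSucc]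
    simp only [Fin.snoc_castSucc, Fin.snoc_last]
    omega
  · rw [Fin.sum_univ_castSucc]
    simp only [Fin.snoc_castSucc, Fin.snoc_last]
    have hlast : ν (Fin.last m) - ((N - ∑ j, q j : ℕ) : ℝ) / N =
        -∑ j, (ν (Fin.castSucc j) - q j / N) := by
      rw [Nat.cast_sub hqN, Nat.cast_sum, sum_sub_distrib, ← sum_div, sub_div, div_self hN'.ne']
      linarith
    rw [hlast, abs_neg]
    have h5 := (abs_sum_le_sum_abs (fun j => ν (Fin.castSucc j) - q j / N) univ).trans herrs
    have h6 : (2 : ℝ) * m / N = m / N + m / N := by ring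
    linarith

/-- The simplex of dimension `d - 1` has `ℓ¹` nets of radius `2 / M` and cardinality
`O(M)^(d-1)` with an absolute implied constant. -/
lemma exists_simplex_net (hd : 1 ≤ d) {M : ℕ} (hM : 1 ≤ M) :
    ∃ S : Finset (stdSimplex ℝ (Fin d)), (#S : ℝ) ≤ (Real.exp 1 * (M + 1)) ^ (d - 1) ∧
      ∀ ν : stdSimplex ℝ (Fin d),
        ∃ p ∈ S, ∑ j, |(ν : Fin d → ℝ) j - (p : Fin d → ℝ) j| ≤ 2 / M := by
  classical
  obtain ⟨m, rfl⟩ : ∃ m, d = m + 1 := ⟨d - 1, by omega⟩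
  have hM' : (0 : ℝ) < M := by exact_mod_cast hM
  rcases Nat.eq_zero_or_pos m with rfl | hm
  · refine ⟨{⟨Pi.single 0 1, single_mem_stdSimplex ℝ 0⟩}, by simp, fun ν =>
      ⟨_, mem_singleton_self _, ?_⟩⟩
    simp only [Subsingleton.elim ν ⟨Pi.single 0 1, single_mem_stdSimplex ℝ 0⟩, sub_self,
      abs_zero, sum_const_zero]
    positivity
  have hm' : (0 : ℝ) < m := by exact_mod_cast hm
  -- the net consists of the points of the simplex with coordinates in `ℤ / N`
  set N := m * M with hNdef
  have hN : 0 < N := Nat.mul_pos hm hM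
  have hN' : (0 : ℝ) < N := by exact_mod_cast hN
  let g : (finsuppAntidiag (univ : Finset (Fin (m + 1))) N) → stdSimplex ℝ (Fin (m + 1)) :=
    fun k => ⟨fun j => (k.1 j : ℝ) / N, fun j => by positivity, by
      have h := (mem_finsuppAntidiag.1 k.2).1
      rw [← sum_div, div_eq_one_iff_eq hN'.ne']
      exact_mod_cast h⟩
  -- `#S ≤ choose (N + m) m ≤ (m (M + 1))^m / m!` and `m^m / m! ≤ e^m`
  refine ⟨univ.image g, ?_, fun ν => ?_⟩
  · have h1 : #(univ.image g) ≤ (N + m).choose m := by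
      refine card_image_le.trans (le_of_eq ?_)
      rw [card_univ, Fintype.card_coe, card_finsuppAntidiag_nat_eq_choose, card_univ,
        Fintype.card_fin, show m + 1 + N - 1 = N + m by omega, Nat.choose_symm_add]
    calc (#(univ.image g) : ℝ) ≤ (N + m).choose m := by exact_mod_cast h1
      _ ≤ ((N + m : ℕ) : ℝ) ^ m / m.factorial := Nat.choose_le_pow_div _ _
      _ = (m : ℝ) ^ m / m.factorial * (M + 1) ^ m := by
          rw [hNdef]
          push_cast
          rw [show (m : ℝ) * M + m = m * (M + 1) by ring, mul_pow]
          ring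
      _ ≤ Real.exp m * (M + 1) ^ m := by
          gcongr
          exact Real.pow_div_factorial_le_exp _ hm'.le m
      _ = _ := by
          rw [mul_pow, ← Real.exp_nat_mul, mul_one, Nat.add_sub_cancel]
  · obtain ⟨k, hk, hle⟩ := exists_rounding hN ν.2
    refine ⟨g ⟨Finsupp.equivFunOnFinite.symm k, by simp [mem_finsuppAntidiag, hk]⟩,
      mem_image_of_mem _ (mem_univ _), hle.trans (le_of_eq ?_)⟩
    rw [hNdef]
    push_cast
    field_simp

/-- Nets of the simplex for the distance `‖ν - μ‖₁ ^ α` on the scales `2 / 2 ^ ℓ`; their logarithmic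
cardinality is proportional to `(d - 1) / α`. -/
lemma exists_simplex_nets (hd : 1 ≤ d) {α : ℝ} (hα : 0 < α) (hα1 : α ≤ 1) :
    ∃ (S : ℕ → Finset (stdSimplex ℝ (Fin d)))
      (π : ℕ → stdSimplex ℝ (Fin d) → stdSimplex ℝ (Fin d)),
      (∀ ℓ ν, π ℓ ν ∈ S ℓ) ∧ #(S 0) = 1 ∧
      (∀ ℓ : ℕ, Real.log #(S ℓ) ≤ ((d : ℝ) - 1) / α * (ℓ + 3)) ∧
      ∀ (ℓ : ℕ) (ν : stdSimplex ℝ (Fin d)),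
        (∑ j, |(ν : Fin d → ℝ) j - (π ℓ ν : Fin d → ℝ) j|) ^ α ≤ 2 * (1 / 2) ^ ℓ := by
  have hd' : (0 : ℝ) ≤ (d : ℝ) - 1 := by
    have : (1 : ℝ) ≤ d := by exact_mod_cast hd
    linarith
  have h2α : (2 : ℝ) ^ α ≤ 2 := by
    simpa using Real.rpow_le_rpow_of_exponent_le one_le_two hα1
  have key : ∀ ℓ : ℕ, ∃ S : Finset (stdSimplex ℝ (Fin d)), (ℓ = 0 → #S = 1) ∧
      Real.log #S ≤ ((d : ℝ) - 1) / α * (ℓ + 3) ∧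
      ∀ ν : stdSimplex ℝ (Fin d), ∃ p ∈ S,
        (∑ j, |(ν : Fin d → ℝ) j - (p : Fin d → ℝ) j|) ^ α ≤ 2 * (1 / 2) ^ ℓ := by
    intro ℓ
    rcases Nat.eq_zero_or_pos ℓ with rfl | hℓ
    · refine ⟨{⟨Pi.single ⟨0, hd⟩ 1, single_mem_stdSimplex ℝ _⟩}, by simp, ?_, fun ν =>
        ⟨_, mem_singleton_self _, ?_⟩⟩
      · simp only [card_singleton, Nat.cast_one, Real.log_one]
        positivity
      · refine (Real.rpow_le_rpow (sum_nonneg fun _ _ => abs_nonneg _)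
          (sum_abs_sub_le_two ν.2 (single_mem_stdSimplex ℝ _)) hα.le).trans ?_
        simpa using h2α
    -- an `ℓ¹` net of radius about `2 / 2 ^ (ℓ / α)` is needed
    set s : ℝ := (2 : ℝ) ^ ((ℓ : ℝ) / α) with hs
    have hs1 : 1 ≤ s := Real.one_le_rpow one_le_two (by positivity)
    have hM : s ≤ ⌈s⌉₊ := Nat.le_ceil s
    have hM1 : 1 ≤ ⌈s⌉₊ := by exact_mod_cast hs1.trans hM
    obtain ⟨S, hcard, hnet⟩ := exists_simplex_net hd hM1
    refine ⟨S, fun h => absurd h hℓ.ne', ?_, fun ν => ?_⟩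
    · have hS : (0 : ℝ) < #S := by
        obtain ⟨p, hp, -⟩ := hnet ⟨Pi.single ⟨0, hd⟩ 1, single_mem_stdSimplex ℝ _⟩
        exact_mod_cast card_pos.2 ⟨p, hp⟩
      have hM2 : (⌈s⌉₊ : ℝ) + 1 ≤ 3 * s := by
        linarith [Nat.ceil_lt_add_one (zero_le_one.trans hs1)]
      have h3 : Real.log 3 ≤ 2 := by
        linarith [Real.log_le_sub_one_of_pos (show (0 : ℝ) < 3 by norm_num)]
      have hlogs : Real.log s ≤ ℓ / α := by
        rw [hs, Real.log_rpow two_pos]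
        have : Real.log 2 ≤ 1 := by
          linarith [Real.log_le_sub_one_of_pos (show (0 : ℝ) < 2 by norm_num)]
        exact mul_le_of_le_one_right (by positivity) this
      have hlogM : Real.log (⌈s⌉₊ + 1) ≤ 2 + ℓ / α := by
        refine (Real.log_le_log (by positivity) hM2).trans ?_
        rw [Real.log_mul (by norm_num) (by linarith)]
        linarith
      calc Real.log #S ≤ Real.log ((Real.exp 1 * (⌈s⌉₊ + 1)) ^ (d - 1)) := Real.log_le_log hS hcard
        _ = ((d : ℝ) - 1) * (1 + Real.log (⌈s⌉₊ + 1)) := by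
            rw [Real.log_pow, Real.log_mul (Real.exp_pos 1).ne' (by positivity), Real.log_exp,
              Nat.cast_sub hd, Nat.cast_one]
        _ ≤ ((d : ℝ) - 1) * (3 / α + ℓ / α) := by
            have : 3 ≤ 3 / α := by rw [le_div_iff₀ hα]; linarith
            exact mul_le_mul_of_nonneg_left (by linarith) hd'
        _ = _ := by ring
    · obtain ⟨p, hp, hle⟩ := hnet ν
      refine ⟨p, hp, ?_⟩
      have h1 : ∑ j, |(ν : Fin d → ℝ) j - (p : Fin d → ℝ) j| ≤ 2 / s :=
        hle.trans (div_le_div_of_nonneg_left two_pos.le (by linarith) hM)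
      refine (Real.rpow_le_rpow (sum_nonneg fun _ _ => abs_nonneg _) h1 hα.le).trans ?_
      rw [Real.div_rpow two_pos.le (by linarith), hs, ← Real.rpow_mul two_pos.le,
        div_mul_cancel₀ _ hα.ne', Real.rpow_natCast, one_div, inv_pow, ← div_eq_mul_inv]
      gcongr
  choose S hS0 hcard hnet using key
  choose π hπ hle using hnet
  exact ⟨S, π, hπ, hS0 0 rfl, hcard, hle⟩

end Simplex

/-! ### Relative utilities -/

section RelativeUtilities

variable {d : ℕ} {u : ℝ → ℝ} {x ν μ : Fin d → ℝ}

lemma le_bestReturn (x : Fin d → ℝ) (j : Fin d) : x j ≤ bestReturn x :=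
  le_ciSup (Set.finite_range x).bddAbove j

lemma bestReturn_pos (hd : 1 ≤ d) (hx : ∀ j, 0 < x j) : 0 < bestReturn x :=
  (hx ⟨0, hd⟩).trans_le (le_bestReturn x _)

lemma dotProduct_le_bestReturn (hν : ν ∈ stdSimplex ℝ (Fin d)) : ν ⬝ᵥ x ≤ bestReturn x := by
  calc ν ⬝ᵥ x ≤ ∑ j, ν j * bestReturn x :=
        sum_le_sum fun j _ => mul_le_mul_of_nonneg_left (le_bestReturn x j) (hν.1 j)
    _ = bestReturn x := by rw [← sum_mul, hν.2, one_mul]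

lemma dotProduct_pos_of_mem_stdSimplex (hν : ν ∈ stdSimplex ℝ (Fin d)) (hx : ∀ j, 0 < x j) :
    0 < ν ⬝ᵥ x := by
  refine sum_pos' (fun j _ => mul_nonneg (hν.1 j) (hx j).le) ?_
  obtain ⟨j, -, hj⟩ : ∃ j ∈ (univ : Finset (Fin d)), 0 < ν j :=
    exists_lt_of_sum_lt (f := fun _ => (0 : ℝ)) (by simp [hν.2])
  exact ⟨j, mem_univ j, mul_pos hj (hx j)⟩

lemma abs_relUtility_le_one (hu : IsUtility u) (hd : 1 ≤ d) (hν : ν ∈ stdSimplex ℝ (Fin d))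
    (hx : ∀ j, 0 < x j) : |relUtility u ν x| ≤ 1 := by
  have h1 := dotProduct_pos_of_mem_stdSimplex hν hx
  have h2 := bestReturn_pos hd hx
  have h3 := hu.mono h1 h2 (dotProduct_le_bestReturn hν)
  rw [relUtility, abs_of_pos (div_pos (hu.pos _ h1) (hu.pos _ h2))]
  exact (div_le_one (hu.pos _ h2)).2 h3

/-- In terms of the returns `x / x*` relative to the best asset, relative utilities are
`α`-Hölder with constant `A K`. -/
lemma abs_relUtility_sub_le {α K A : ℝ} (hu : IsUtility u) (hd : 1 ≤ d) (hK : 0 < K)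
    (hHol : ∀ x y : ℝ, 0 < x → 0 < y → |u x - u y| ≤ K * |x - y| ^ α)
    (hA : ∀ y, 0 < y → y ^ α / u y ≤ A) (hν : ν ∈ stdSimplex ℝ (Fin d))
    (hμ : μ ∈ stdSimplex ℝ (Fin d)) (hx : ∀ j, 0 < x j) :
    |relUtility u ν x - relUtility u μ x| ≤
      A * K * |∑ j, (ν j - μ j) * (x j / bestReturn x)| ^ α := by
  set s := bestReturn x
  have hs : 0 < s := bestReturn_pos hd hx
  have hus := hu.pos s hs
  have h1 : ν ⬝ᵥ x - μ ⬝ᵥ x = s * ∑ j, (ν j - μ j) * (x j / s) := by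
    rw [mul_sum, dotProduct, dotProduct, ← sum_sub_distrib]
    refine sum_congr rfl fun j _ => ?_
    field_simp
  have h2 := hHol _ _ (dotProduct_pos_of_mem_stdSimplex hν hx)
    (dotProduct_pos_of_mem_stdSimplex hμ hx)
  rw [h1, abs_mul, abs_of_pos hs, Real.mul_rpow hs.le (abs_nonneg _)] at h2
  rw [relUtility, relUtility, ← sub_div, abs_div, abs_of_pos hus]
  calc _ ≤ K * (s ^ α * |∑ j, (ν j - μ j) * (x j / s)| ^ α) / u s := by gcongr
    _ = s ^ α / u s * (K * |∑ j, (ν j - μ j) * (x j / s)| ^ α) := by ring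
    _ ≤ A * (K * |∑ j, (ν j - μ j) * (x j / s)| ^ α) := by
        gcongr
        exact hA s hs
    _ = _ := by ring

lemma abs_div_bestReturn_le_one (hd : 1 ≤ d) (hx : ∀ j, 0 < x j) (j : Fin d) :
    |x j / bestReturn x| ≤ 1 := by
  have hs := bestReturn_pos hd hx
  rw [abs_of_pos (div_pos (hx j) hs)]
  exact (div_le_one hs).2 (le_bestReturn x j)

lemma continuous_relUtility (hu : IsUtility u) (hx : ∀ j, 0 < x j) :
    Continuous fun ν : stdSimplex ℝ (Fin d) => relUtility u ν x := by
  refine (hu.cont.comp_continuous ?_ fun ν =>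
    dotProduct_pos_of_mem_stdSimplex ν.2 hx).div_const _
  exact continuous_finsetSum _ fun j _ =>
    ((continuous_apply j).comp continuous_subtype_val).mul continuous_const

lemma measurable_utility_comp (hu : IsUtility u) {Y : Type*} [MeasurableSpace Y] {h : Y → ℝ}
    (hm : Measurable h) (hpos : ∀ y, 0 < h y) : Measurable fun y => u (h y) := by
  -- `u` itself need not be measurable off `(0, ∞)`, but `u ∘ exp` is continuous
  have hc : Continuous fun t : ℝ => u (Real.exp t) :=
    hu.cont.comp_continuous Real.continuous_exp fun t => Real.exp_pos t
  have h2 := hc.measurable.comp (Real.measurable_log.comp hm)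
  simpa [Function.comp_def, Real.exp_log (hpos _)] using h2

/-- Replaces the non-positive coordinates of a vector by `1`. Relative utilities become total
functions of the returns by composition with this map. -/
def posReturns (x : Fin d → ℝ) : Fin d → ℝ := fun j => if 0 < x j then x j else 1

lemma posReturns_pos (x : Fin d → ℝ) (j : Fin d) : 0 < posReturns x j := by
  unfold posReturns
  split_ifs with h
  exacts [h, one_pos]

lemma posReturns_eq_self (hx : ∀ j, 0 < x j) : posReturns x = x :=
  funext fun j => if_pos (hx j)

lemma measurable_posReturns : Measurable (posReturns (d := d)) :=
  measurable_pi_lambda _ fun j => Measurable.ite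
    (measurableSet_lt measurable_const (measurable_pi_apply j)) (measurable_pi_apply j)
    measurable_const

lemma measurable_relUtility_posReturns (hu : IsUtility u) (hd : 1 ≤ d)
    (hν : ν ∈ stdSimplex ℝ (Fin d)) : Measurable fun x => relUtility u ν (posReturns x) := by
  have hj : ∀ j, Measurable fun x : Fin d → ℝ => posReturns x j := fun j =>
    (measurable_pi_apply j).comp measurable_posReturns
  refine (measurable_utility_comp hu ?_ fun x =>
    dotProduct_pos_of_mem_stdSimplex hν (posReturns_pos x)).div
    (measurable_utility_comp hu ?_ fun x => bestReturn_pos hd (posReturns_pos x))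
  · exact measurable_fun_sum _ fun j _ => measurable_const.mul (hj j)
  · exact Measurable.iSup hj

/-! ### Rademacher averages of relative utilities -/

variable {ι : Type*} [Fintype ι] [DecidableEq ι]

/-- For Lipschitz utilities the contraction principle reduces the Rademacher average to that of a
linear functional on the simplex, whose supremum is attained at a vertex. -/
lemma expect_iSup_relUtility_le_of_lipschitz {K A : ℝ} (hu : IsUtility u) (hd : 1 ≤ d)
    (hK : 0 < K) (hHol : ∀ x y : ℝ, 0 < x → 0 < y → |u x - u y| ≤ K * |x - y| ^ (1 : ℝ))
    (hA : ∀ y, 0 < y → y ^ (1 : ℝ) / u y ≤ A) (hA0 : 0 ≤ A) {x : ι → Fin d → ℝ}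
    (hx : ∀ k j, 0 < x k j) :
    𝔼 ε : ι → Bool, ⨆ ν : stdSimplex ℝ (Fin d), signSum ε (fun k => relUtility u ν (x k)) ≤
      A * K * √(Fintype.card ι) * √(2 * Real.log d) := by
  classical
  have : Nonempty (stdSimplex ℝ (Fin d)) := ⟨⟨Pi.single ⟨0, hd⟩ 1, single_mem_stdSimplex ℝ _⟩⟩
  have hAK : 0 ≤ A * K := by positivity
  let y : Fin d → ι → ℝ := fun j k => A * K * (x k j / bestReturn (x k))
  have hy : ∀ j k, |y j k| ≤ A * K := fun j k => by
    rw [abs_mul, abs_of_nonneg hAK]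
    exact mul_le_of_le_one_right hAK (abs_div_bestReturn_le_one hd (hx k) j)
  let ψ : stdSimplex ℝ (Fin d) → ι → ℝ := fun ν k => ∑ j, (ν : Fin d → ℝ) j * y j k
  have hψ : ∀ ν k, |ψ ν k| ≤ A * K := fun ν k => by
    calc |ψ ν k| ≤ ∑ j, (ν : Fin d → ℝ) j * (A * K) := by
          refine (abs_sum_le_sum_abs _ _).trans (sum_le_sum fun j _ => ?_)
          rw [abs_mul, abs_of_nonneg (stdSimplex.zero_le ν j)]
          exact mul_le_mul_of_nonneg_left (hy j k) (ν.2.1 j)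
      _ = A * K := by rw [← sum_mul, stdSimplex.sum_eq_one, one_mul]
  have hcontr : 𝔼 ε : ι → Bool, ⨆ ν : stdSimplex ℝ (Fin d),
      signSum ε (fun k => relUtility u ν (x k)) ≤ 𝔼 ε : ι → Bool, ⨆ ν, signSum ε (ψ ν) := by
    refine expect_iSup_signSum_le (B := max 1 (A * K))
      (fun ν k => (abs_relUtility_le_one hu hd ν.2 (hx k)).trans (le_max_left _ _))
      (fun ν k => (hψ ν k).trans (le_max_right _ _)) fun k ν μ => ?_
    refine (abs_relUtility_sub_le hu hd hK hHol hA ν.2 μ.2 (hx k)).trans (le_of_eq ?_)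
    rw [Real.rpow_one]
    nth_rewrite 1 [← abs_of_nonneg hAK]
    rw [← abs_mul, mul_sum, ← sum_sub_distrib]
    congr 1
    refine sum_congr rfl fun j _ => ?_
    change A * K * ((ν j - μ j) * _) = _
    ring
  have hne : (univ.image y).Nonempty := ⟨_, mem_image_of_mem y (mem_univ ⟨0, hd⟩)⟩
  have hmax := expect_le_of_le_signSum (S := univ.image y) (τ := √(Fintype.card ι) * (A * K))
    (M := fun ε => ⨆ ν, signSum ε (ψ ν)) (by positivity) (fun v hv => ?_) fun ε => ?_
  · refine hcontr.trans (hmax.trans ?_)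
    have hcard : (#(univ.image y) : ℝ) ≤ d := by
      exact_mod_cast card_image_le.trans (by simp)
    have hpos : (0 : ℝ) < #(univ.image y) := by exact_mod_cast card_pos.2 hne
    rw [mul_comm (√(Fintype.card ι : ℝ))]
    gcongr
  · obtain ⟨j, -, rfl⟩ := mem_image.1 hv
    have h2 : ∀ k ∈ (univ : Finset ι), y j k ^ 2 ≤ (A * K) ^ 2 := fun k _ =>
      sq_le_sq' (abs_le.1 (hy j k)).1 (abs_le.1 (hy j k)).2
    refine (sum_le_card_nsmul _ _ _ h2).trans (le_of_eq ?_)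
    rw [nsmul_eq_mul, card_univ, mul_pow √(Fintype.card ι : ℝ), Real.sq_sqrt (by positivity)]
  · obtain ⟨v, hv, hle⟩ := exists_max_image _ (signSum ε) hne
    refine ⟨v, hv, ciSup_le fun ν => ?_⟩
    have hlin : signSum ε (ψ ν) = ∑ j, (ν : Fin d → ℝ) j * signSum ε (y j) := by
      simp only [signSum, ψ, mul_sum]
      rw [sum_comm]
      exact sum_congr rfl fun j _ => sum_congr rfl fun k _ => by ring
    calc signSum ε (ψ ν) ≤ ∑ j, (ν : Fin d → ℝ) j * signSum ε v := by
          rw [hlin]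
          exact sum_le_sum fun j _ => mul_le_mul_of_nonneg_left
            (hle _ (mem_image_of_mem y (mem_univ j))) (ν.2.1 j)
      _ = signSum ε v := by rw [← sum_mul, stdSimplex.sum_eq_one, one_mul]

/-- For Hölder utilities the Rademacher average is bounded by chaining along nets of the
simplex. -/
lemma expect_iSup_relUtility_le_of_holder {α K A : ℝ} (hu : IsUtility u) (hd : 1 ≤ d)
    (hα : 0 < α) (hα1 : α ≤ 1) (hK : 0 < K)
    (hHol : ∀ x y : ℝ, 0 < x → 0 < y → |u x - u y| ≤ K * |x - y| ^ α)
    (hA : ∀ y, 0 < y → y ^ α / u y ≤ A) (hA0 : 0 ≤ A) {x : ι → Fin d → ℝ}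
    (hx : ∀ k j, 0 < x k j) :
    𝔼 ε : ι → Bool, ⨆ ν : stdSimplex ℝ (Fin d), signSum ε (fun k => relUtility u ν (x k)) ≤
      30 * A * K * √(Fintype.card ι * (((d : ℝ) - 1) / α)) := by
  have : Nonempty (stdSimplex ℝ (Fin d)) := ⟨⟨Pi.single ⟨0, hd⟩ 1, single_mem_stdSimplex ℝ _⟩⟩
  have hd' : (0 : ℝ) ≤ (d : ℝ) - 1 := by
    have : (1 : ℝ) ≤ d := by exact_mod_cast hd
    linarith
  obtain ⟨S, π, hπ, hS0, hS, hle⟩ := exists_simplex_nets hd hα hα1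
  refine (expect_iSup_signSum_le_of_nets (D := 2 * (A * K)) (by positivity)
    (div_nonneg hd' hα.le) S π hπ hS0 hS fun ℓ ν k => ?_).trans (le_of_eq (by ring))
  calc _ ≤ A * K * |∑ j, ((ν : Fin d → ℝ) j - (π ℓ ν : Fin d → ℝ) j) *
          (x k j / bestReturn (x k))| ^ α :=
        abs_relUtility_sub_le hu hd hK hHol hA ν.2 (π ℓ ν).2 (hx k)
    _ ≤ A * K * (∑ j, |(ν : Fin d → ℝ) j - (π ℓ ν : Fin d → ℝ) j|) ^ α := by
        gcongr
        refine (abs_sum_le_sum_abs _ _).trans (sum_le_sum fun j _ => ?_)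
        rw [abs_mul]
        exact mul_le_of_le_one_right (abs_nonneg _) (abs_div_bestReturn_le_one hd (hx k) j)
    _ ≤ A * K * (2 * (1 / 2) ^ ℓ) := by
        gcongr
        exact hle ℓ ν
    _ = 2 * (A * K) * (1 / 2) ^ ℓ := by ring

end RelativeUtilities

/-! ### The empirical process -/

section EmpiricalProcess

variable {Ω : Type*} [MeasurableSpace Ω] {P : Measure Ω} [IsProbabilityMeasure P]
  {d n : ℕ} {u : ℝ → ℝ} {r : Fin (n + 1) → Ω → Fin d → ℝ}

/-- The sample `r_1, …, r_n` has the product law. -/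
lemma measurePreserving_sample (hm : ∀ k, Measurable (r k)) (hind : iIndepFun r P)
    (hid : ∀ k l, IdentDistrib (r k) (r l) P P) :
    MeasurePreserving (fun ω (k : Fin n) => r k.castSucc ω) P
      (Measure.pi fun _ => P.map (r (Fin.last n))) := by
  refine ⟨measurable_pi_lambda _ fun k => hm _, ?_⟩
  have h := (iIndepFun_iff_map_fun_eq_pi_map
    (fun k : Fin n => (hm k.castSucc).aemeasurable)).1
    (hind.precomp (Fin.castSucc_injective n))
  simp only [(hid _ (Fin.last n)).map_eq] at h
  exact h

omit [IsProbabilityMeasure P] in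
/-- The true utility in terms of the law of the returns. -/
lemma trueUtility_eq (hu : IsUtility u) (hd : 1 ≤ d) (hm : ∀ k, Measurable (r k))
    (hpos : ∀ k ω j, 0 < r k ω j) {ν : Fin d → ℝ} (hν : ν ∈ stdSimplex ℝ (Fin d)) :
    trueUtility P u r ν = ∫ x, relUtility u ν (posReturns x) ∂(P.map (r (Fin.last n))) := by
  rw [integral_map (hm _).aemeasurable
    (measurable_relUtility_posReturns hu hd hν).aestronglyMeasurable]
  simp only [posReturns_eq_self (hpos _ _), trueUtility]

lemma bddAbove_range_empProcess (hu : IsUtility u) (hd : 1 ≤ d) (hn : 1 ≤ n)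
    (hpos : ∀ k ω j, 0 < r k ω j) (ω : Ω) :
    BddAbove (Set.range fun ν : stdSimplex ℝ (Fin d) => empProcess P u r ν ω) := by
  refine ⟨1 + 1, ?_⟩
  rintro _ ⟨ν, rfl⟩
  have hn0 : (0 : ℝ) < n := by exact_mod_cast hn
  have h1 : empUtility u r ν ω ≤ 1 := by
    have h := sum_le_card_nsmul (univ : Finset (Fin n)) (fun k => relUtility u ν (r k.castSucc ω)) 1
      fun k _ => (abs_le.1 (abs_relUtility_le_one hu hd ν.2 (hpos _ ω))).2
    rw [card_univ, Fintype.card_fin, nsmul_eq_mul, mul_one] at h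
    rw [empUtility, one_div_mul_eq_div]
    exact (div_le_one hn0).2 h
  have h2 : ‖∫ ω, relUtility u ν (r (Fin.last n) ω) ∂P‖ ≤ 1 * P.real Set.univ :=
    norm_integral_le_of_norm_le_const (Filter.Eventually.of_forall fun ω =>
      abs_relUtility_le_one hu hd ν.2 (hpos _ ω))
  rw [probReal_univ, mul_one] at h2
  change empUtility u r ν ω - ∫ ω, relUtility u ν (r (Fin.last n) ω) ∂P ≤ 1 + 1
  linarith [(abs_le.1 h2).1]

omit [IsProbabilityMeasure P] in
/-- The supremum of the empirical process as a function of the sample. -/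
lemma supEmpProcess_eq (hu : IsUtility u) (hd : 1 ≤ d) (hn : 1 ≤ n) (hm : ∀ k, Measurable (r k))
    (hpos : ∀ k ω j, 0 < r k ω j) (ω : Ω) :
    supEmpProcess P u r ω = 1 / (n : ℝ) * ⨆ ν : stdSimplex ℝ (Fin d), ∑ k : Fin n,
      (relUtility u ν (posReturns (r k.castSucc ω)) -
        ∫ x, relUtility u ν (posReturns x) ∂(P.map (r (Fin.last n)))) := by
  have hn' : (n : ℝ) ≠ 0 := by positivity
  rw [supEmpProcess, Real.mul_iSup_of_nonneg (by positivity)]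
  congr 1
  funext ν
  rw [empProcess, empUtility, trueUtility_eq hu hd hm hpos (ν := ν) ν.2]
  simp only [posReturns_eq_self (hpos _ _), sum_sub_distrib, sum_const, card_univ,
    Fintype.card_fin, nsmul_eq_mul]
  field_simp

lemma integrable_supEmpProcess (hu : IsUtility u) (hd : 1 ≤ d) (hn : 1 ≤ n)
    (hm : ∀ k, Measurable (r k)) (hpos : ∀ k ω j, 0 < r k ω j) (hind : iIndepFun r P)
    (hid : ∀ k l, IdentDistrib (r k) (r l) P P) : Integrable (supEmpProcess P u r) P := by
  have : Nonempty (stdSimplex ℝ (Fin d)) := ⟨⟨Pi.single ⟨0, hd⟩ 1, single_mem_stdSimplex ℝ _⟩⟩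
  have := Measure.isProbabilityMeasure_map (μ := P) (hm (Fin.last n)).aemeasurable
  have hF := (measurePreserving_sample hm hind hid).integrable_comp_of_integrable
    (integrable_iSup_sum_sub_integral (ι := Fin n) (μ := P.map (r (Fin.last n)))
      (f := fun (ν : stdSimplex ℝ (Fin d)) x => relUtility u ν (posReturns x)) (B := 1)
      (fun x => continuous_relUtility hu (posReturns_pos x))
      (fun ν => measurable_relUtility_posReturns hu hd ν.2)
      fun ν x => abs_relUtility_le_one hu hd ν.2 (posReturns_pos x))
  rw [funext (supEmpProcess_eq hu hd hn hm hpos)]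
  exact hF.const_mul _

/-- A uniform bound for the Rademacher averages of relative utilities controls the expected
supremum of the empirical process. -/
lemma integral_supEmpProcess_le (hu : IsUtility u) (hd : 1 ≤ d) (hn : 1 ≤ n)
    (hm : ∀ k, Measurable (r k)) (hpos : ∀ k ω j, 0 < r k ω j) (hind : iIndepFun r P)
    (hid : ∀ k l, IdentDistrib (r k) (r l) P P) {b : ℝ}
    (hb : ∀ x : Fin n → Fin d → ℝ, (∀ k j, 0 < x k j) →
      𝔼 ε : Fin n → Bool, ⨆ ν : stdSimplex ℝ (Fin d),
        signSum ε (fun k => relUtility u ν (x k)) ≤ b) (hb0 : 0 ≤ b) :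
    ∫ ω, supEmpProcess P u r ω ∂P ≤ 2 * b / n := by
  have : Nonempty (stdSimplex ℝ (Fin d)) := ⟨⟨Pi.single ⟨0, hd⟩ 1, single_mem_stdSimplex ℝ _⟩⟩
  set μ := P.map (r (Fin.last n))
  have : IsProbabilityMeasure μ := Measure.isProbabilityMeasure_map (hm _).aemeasurable
  let f : stdSimplex ℝ (Fin d) → (Fin d → ℝ) → ℝ := fun ν x => relUtility u ν (posReturns x)
  have hc : ∀ x, Continuous (f · x) := fun x => continuous_relUtility hu (posReturns_pos x)
  have hfm : ∀ ν, Measurable (f ν) := fun ν => measurable_relUtility_posReturns hu hd ν.2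
  have hB : ∀ ν x, |f ν x| ≤ 1 := fun ν x =>
    abs_relUtility_le_one hu hd ν.2 (posReturns_pos x)
  have hmp := measurePreserving_sample hm hind hid
  have hF := integrable_iSup_sum_sub_integral (ι := Fin n) (μ := μ) hc hfm hB
  have h1 : ∫ ω, supEmpProcess P u r ω ∂P = 1 / (n : ℝ) *
      ∫ x, ⨆ ν, ∑ k : Fin n, (f ν (x k) - ∫ y, f ν y ∂μ) ∂(Measure.pi fun _ => μ) := by
    rw [← hmp.map_eq, integral_map hmp.measurable.aemeasurable
      (by rw [hmp.map_eq]; exact hF.aestronglyMeasurable), ← integral_const_mul]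
    exact integral_congr_ae (Filter.Eventually.of_forall
      (supEmpProcess_eq hu hd hn hm hpos))
  have h2 := integral_iSup_le_two_mul_rademacher (ι := Fin n) (μ := μ) hc hfm hB
  have h3 : ∫ x, 𝔼 ε : Fin n → Bool, ⨆ ν, signSum ε (fun k => f ν (x k))
      ∂(Measure.pi fun _ : Fin n => μ) ≤ b := by
    -- if the average were not integrable, its integral would be `0`, so no measurability is needed
    by_cases hi : Integrable (fun x : Fin n → Fin d → ℝ => 𝔼 ε : Fin n → Bool, ⨆ ν,
        signSum ε (fun k => f ν (x k))) (Measure.pi fun _ : Fin n => μ)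
    · refine (integral_mono hi (integrable_const b) fun x =>
        hb _ fun k => posReturns_pos (x k)).trans (le_of_eq (by simp))
    · rwa [integral_undef hi]
  rw [h1]
  calc _ ≤ 1 / (n : ℝ) * (2 * b) := by gcongr; exact h2.trans (by linarith)
    _ = 2 * b / n := by ring

end EmpiricalProcess

end RelativeUtility

end

theorem theorem2 :
    ∃ C : ℝ, 0 < C ∧
      ∀ (d n : ℕ), 1 ≤ d → 1 ≤ n →
      ∀ (u : ℝ → ℝ), RelativeUtility.IsUtility u →
      ∀ (α K A : ℝ), 0 < α → α ≤ 1 → 0 < K →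
      (∀ x y : ℝ, 0 < x → 0 < y → |u x - u y| ≤ K * |x - y| ^ α) →
      IsLUB ((fun x : ℝ => x ^ α / u x) '' Set.Ioi 0) A →
      ∀ (Ω : Type*) [MeasurableSpace Ω] (P : Measure Ω) [IsProbabilityMeasure P]
        (r : Fin (n + 1) → Ω → Fin d → ℝ),
      (∀ k, Measurable (r k)) →
      (∀ k ω j, 0 < r k ω j) →
      iIndepFun r P →
      (∀ k l, IdentDistrib (r k) (r l) P P) →
      -- `U` and the supremum of `G_n` are well defined
      (∀ ν ∈ stdSimplex ℝ (Fin d),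
        Integrable (fun ω => RelativeUtility.relUtility u ν (r (Fin.last n) ω)) P) ∧
      (∀ ω, BddAbove (Set.range fun ν : stdSimplex ℝ (Fin d) =>
        RelativeUtility.empProcess P u r (ν : Fin d → ℝ) ω)) ∧
      Integrable (RelativeUtility.supEmpProcess P u r) P ∧
      -- the bounds
      (α = 1 → ∫ ω, RelativeUtility.supEmpProcess P u r ω ∂P
        ≤ 2 * A * K * Real.sqrt (2 * Real.log d / n)) ∧
      (α < 1 → ∫ ω, RelativeUtility.supEmpProcess P u r ω ∂P
        ≤ C * A * K * Real.sqrt (((d : ℝ) - 1) / (α * n))) := by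
  refine ⟨60, by norm_num, ?_⟩
  intro d n hd hn u hu α K A hα hα1 hK hHol hLUB Ω _ P _ r hm hpos hind hid
  have hA : ∀ y, 0 < y → y ^ α / u y ≤ A := fun y hy => hLUB.1 ⟨y, hy, rfl⟩
  have hA0 : 0 ≤ A := le_trans (div_nonneg (Real.rpow_nonneg zero_le_one _)
    (hu.pos 1 one_pos).le) (hA 1 one_pos)
  have hn0 : (0 : ℝ) < n := by exact_mod_cast hn
  -- the bounds on the Rademacher averages are of order `√n` and get divided by `n`
  have hsqrt : ∀ a : ℝ, √n * √a / n = √(a / n) := fun a => by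
    rw [Real.sqrt_div' _ hn0.le, div_eq_div_iff hn0.ne' (Real.sqrt_pos.2 hn0).ne']
    rw [mul_right_comm, Real.mul_self_sqrt hn0.le, mul_comm]
  refine ⟨fun ν hν => ?_, fun ω => RelativeUtility.bddAbove_range_empProcess hu hd hn hpos ω,
    RelativeUtility.integrable_supEmpProcess hu hd hn hm hpos hind hid, ?_, ?_⟩
  · have h := (RelativeUtility.measurable_relUtility_posReturns hu hd hν).comp (hm (Fin.last n))
    refine Integrable.of_bound (C := 1) ?_ (Filter.Eventually.of_forall fun ω =>
      RelativeUtility.abs_relUtility_le_one hu hd hν (hpos _ ω))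
    refine h.aestronglyMeasurable.congr (Filter.Eventually.of_forall fun ω => ?_)
    simp [RelativeUtility.posReturns_eq_self (hpos _ ω)]
  · rintro rfl
    refine (RelativeUtility.integral_supEmpProcess_le hu hd hn hm hpos hind hid (fun x hx =>
      RelativeUtility.expect_iSup_relUtility_le_of_lipschitz hu hd hK hHol hA hA0 hx)
      (by positivity)).trans (le_of_eq ?_)
    rw [← hsqrt, Fintype.card_fin]
    ring
  · intro _
    refine (RelativeUtility.integral_supEmpProcess_le hu hd hn hm hpos hind hid (fun x hx =>
      RelativeUtility.expect_iSup_relUtility_le_of_holder hu hd hα hα1 hK hHol hA hA0 hx)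
      (by positivity)).trans (le_of_eq ?_)
    rw [← div_div, ← hsqrt, Fintype.card_fin, Real.sqrt_mul hn0.le]
    ring
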